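/- **Setting.** Let $q,b:\mathbb R\to\mathbb R$ with $b\in C^2$ and $b''>0$, and consider the GLM with canonical link and dispersion $1$, $p(y\mid x,\beta)=q(y)\exp\{y\,x'\beta-b(x'\beta)\}$, $\beta\in\mathbb R^p$. Along a sequence with $n\to\infty$ (all objects below are indexed by it) let $D=(n,Y,X)$ be the current data and $D_0=(n_0,Y_0,X_0)$ the historical data, with $q>0$ at all observed responses, $L(\beta\mid D)=Q(Y)\exp\{\sum_{i\le n}y_ix_i'\beta-\sum_{i\le n}b(x_i'\beta)\}$, $Q(Y)=\prod_i q(y_i)$, and likewise $L(\beta\mid D_0)$. Let $\pi_0\ge0$ be the (possibly improper) initial prior of $\beta$ and $\pi$ a probability density on $(0,1]$ for $a_0$. Put $c^*(a_0)=\int L(\beta\mid D_0)^{a_0}\pi_0(\beta)\,d\beta$, and let $$\pi(a_0\mid D,D_0)\ \propto\ \int_{\mathbb R^p} L(\beta\mid D)\,\frac{L(\beta\mid D_0)^{a_0}\pi_0(\beta)}{c^*(a_0)}\,\pi(a_0)\,d\beta$$ be the marginal posterior density of $a_0\in(0,1]$ under the normalized power prior; it is assumed that $L(\cdot\mid D_0)^{a_0}\pi_0$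 and $L(\cdot\mid D)L(\cdot\mid D_0)^{a_0}\pi_0$ are integrable for every $a_0\in(0,1]$ and that the right-hand side is integrable in $a_0$ over $(0,1)$. Define $$g_n(\beta)=-\tfrac1n\Big\{\log Q(Y)+(a_0+1)\sum_{i\le n} y_ix_i'\beta-\sum_{i\le n} b(x_i'\beta)-a_0\sum_{i\le n_0}b(x_{0i}'\beta)\Big\},$$ $$k_n(\beta)=-\tfrac1n\Big\{a_0\sum_{i\le n} y_ix_i'\beta-a_0\sum_{i\le n_0}b(x_{0i}'\beta)\Big\}.$$ For every $a_0\in(0,1]$ let $\hat\beta=\hat\beta_n(a_0)$ be a maximizer of $-g_n$ and $\tilde\beta=\tilde\beta_n(a_0)$ a maximizer of $-k_n$ (both are assumed to exist), and put $$\hat\Sigma_g=\Big[\tfrac1n\sum_{i\le n}b''(x_i'\hat\beta)x_ix_i'+\tfrac{a_0}n\sum_{i\le n_0}b''(x_{0i}'\hat\beta)x_{0i}x_{0i}'\Big]^{-1},\qquad \tilde\Sigma_k=\Big[\tfrac{a_0}n\sum_{i\le n_0}b''(x_{0i}'\tilde\beta)x_{0i}x_{0i}'\Big]^{-1}.$$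 **Regularity conditions.** Let $K\subseteq(0,1]$. Let $\ell$ be $\log L(\beta\mid D)+a_0\log L(\beta\mid D_0)$ with mode $\beta^*=\hat\beta_n(a_0)$, or $a_0\log L(\beta\mid D_0)$ with mode $\beta^*=\tilde\beta_n(a_0)$, and $J=-\partial^2\ell/\partial\beta\,\partial\beta'$. For each of these two choices the following conditions are called regularity on $K$: * (C0) there is a compact set $M\subset\mathbb R^p$, at every point of which $\pi_0$ is positive and continuous, such that the distance of $\beta^*$ to $M$ tends to $0$ uniformly in $a_0\in K$; * (C1) the smallest eigenvalue of $J(\beta^*)$ tends to $\infty$ uniformly in $a_0\in K$; * (C2) for every $\varepsilon>0$ there is $\rho>0$ such that for all late members of the sequence, all $a_0\in K$ and all $\beta$ with $|\beta-\beta^*|\le\rho$ one has $(1-\varepsilon)J(\beta^*)\le J(\beta)\le(1+\varepsilon)J(\beta^*)$ (Loewner order); * (C3) either $\pi_0$ is bounded, or for every $\rho>0$ the mass that the probability density proportional to $e^{\ell}\pi_0$ gives to $\{|\beta-\beta^*|>\rho\}$ tends to $0$ uniformly in $a_0\in K$. **Theorem.** Suppose $X$ is $n\times p$ of rank $p$ and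 $X_0$ is $n_0\times p$ of rank $p$, $n_0/n=r$ with a constant $r>0$, and $X'Y=X_0'Y_0$ (where $X_0$ need not be equal to $X$). Then there are constants $C_n>0$ that do not depend on $a_0$ such that, for every $K\subseteq(0,1]$ on which the regularity conditions hold, uniformly in $a_0\in K$ as $n\to\infty$, $$\pi(a_0\mid D,D_0)=C_n\,\pi(a_0)\,\frac{|\hat\Sigma_g|^{1/2}}{|\tilde\Sigma_k|^{1/2}}\,\exp\{-n[g_n(\hat\beta)-k_n(\tilde\beta)]\}\,(1+o(1))$$ if $\pi_0(\hat\beta)/\pi_0(\tilde\beta)\to1$ uniformly on $K$ (in particular if $\pi_0$ is constant), and without that condition on $\pi_0$ $$\pi(a_0\mid D,D_0)=C_n\,\pi(a_0)\,\frac{|\hat\Sigma_g|^{1/2}}{|\tilde\Sigma_k|^{1/2}}\,\exp\{-n[g_n(\hat\beta)-k_n(\tilde\beta)]\}\,\frac{\pi_0(\hat\beta)}{\pi_0(\tilde\beta)}\,(1+o(1)).$$ -/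

import Mathlib

open Set Filter Topology MeasureTheory Matrix

noncomputable section

namespace GLMPowerPrior

/-- The space of regression coefficients, `ℝ^p` with the Euclidean norm and Lebesgue measure. -/
abbrev Coef (p : ℕ) : Type := EuclideanSpace ℝ (Fin p)

/-- A regression data set `(n, Y, X)`: the responses `Y ∈ ℝ^n` and the `n × p` design matrix `X`,
whose `i`-th row is the covariate vector `x_i`. -/
structure Data (p : ℕ) where
  n : ℕ
  Y : Fin n → ℝ
  X : Matrix (Fin n) (Fin p) ℝ

variable {p : ℕ}

/-- The linear predictor `x_i'β`. -/
def Data.linPred (D : Data p) (i : Fin D.n) (β : Coef p) : ℝ := ∑ j, D.X i j * β j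

/-- `Q(Y) = ∏ q(y_i)`. -/
def Data.Q (q : ℝ → ℝ) (D : Data p) : ℝ := ∏ i, q (D.Y i)

/-- The likelihood `L(β | D)` of the canonical-link GLM with dispersion parameter `1`: the product
of the densities `q(y_i) exp(y_i x_i'β - b(x_i'β))`. -/
def likelihood (q b : ℝ → ℝ) (D : Data p) (β : Coef p) : ℝ :=
  ∏ i, q (D.Y i) * Real.exp (D.Y i * D.linPred i β - b (D.linPred i β))

/-- The normalizing function `c*(a₀) = ∫ L(β | D₀)^{a₀} π₀(β) dβ`. -/
def normConst (q b : ℝ → ℝ) (π₀ : Coef p → ℝ) (D₀ : Data p) (a₀ : ℝ) : ℝ :=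
  ∫ β : Coef p, likelihood q b D₀ β ^ a₀ * π₀ β

/-- The unnormalized joint posterior of `(β, a₀)` under the normalized power prior,
`L(β | D) · L(β | D₀)^{a₀} π₀(β) / c*(a₀) · π(a₀)`. -/
def jointKernel (q b : ℝ → ℝ) (π₀ : Coef p → ℝ) (π : ℝ → ℝ) (D D₀ : Data p)
    (β : Coef p) (a₀ : ℝ) : ℝ :=
  likelihood q b D β * (likelihood q b D₀ β ^ a₀ * π₀ β / normConst q b π₀ D₀ a₀) * π a₀

/-- The unnormalized marginal posterior of `a₀`. -/
def marginalKernel (q b : ℝ → ℝ) (π₀ : Coef p → ℝ) (π : ℝ → ℝ) (D D₀ : Data p) (a₀ : ℝ) : ℝ :=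
  ∫ β : Coef p, jointKernel q b π₀ π D D₀ β a₀

/-- The marginal posterior density `π(a₀ | D, D₀)` of `a₀` on `(0, 1]`. -/
def marginalPosterior (q b : ℝ → ℝ) (π₀ : Coef p → ℝ) (π : ℝ → ℝ) (D D₀ : Data p) (a₀ : ℝ) : ℝ :=
  marginalKernel q b π₀ π D D₀ a₀ / ∫ a in (0 : ℝ)..1, marginalKernel q b π₀ π D D₀ a

/-- `g_n(β) = -(1/n) {log Q(Y) + (a₀+1) ∑ y_i x_i'β - ∑ b(x_i'β) - a₀ ∑ b(x_{0i}'β)}`. -/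
def g (q b : ℝ → ℝ) (D D₀ : Data p) (a₀ : ℝ) (β : Coef p) : ℝ :=
  -(1 / (D.n : ℝ)) * (Real.log (D.Q q) + (a₀ + 1) * ∑ i, D.Y i * D.linPred i β
    - ∑ i, b (D.linPred i β) - a₀ * ∑ i, b (D₀.linPred i β))

/-- `k_n(β) = -(1/n) {a₀ ∑ y_i x_i'β - a₀ ∑ b(x_{0i}'β)}`. -/
def k (b : ℝ → ℝ) (D D₀ : Data p) (a₀ : ℝ) (β : Coef p) : ℝ :=
  -(1 / (D.n : ℝ)) * (a₀ * ∑ i, D.Y i * D.linPred i β - a₀ * ∑ i, b (D₀.linPred i β))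

/-- `∑ b''(x_i'β) x_i x_i'`, minus the Hessian of the log-likelihood of `D` at `β`. -/
def info (b : ℝ → ℝ) (D : Data p) (β : Coef p) : Matrix (Fin p) (Fin p) ℝ :=
  ∑ i, deriv (deriv b) (D.linPred i β) • vecMulVec (D.X i) (D.X i)

/-- Minus the Hessian of `log L(β | D) + a₀ log L(β | D₀)`. -/
def infoG (b : ℝ → ℝ) (D D₀ : Data p) (a₀ : ℝ) (β : Coef p) : Matrix (Fin p) (Fin p) ℝ :=
  info b D β + a₀ • info b D₀ β

/-- Minus the Hessian of `a₀ log L(β | D₀)`. -/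
def infoK (b : ℝ → ℝ) (D₀ : Data p) (a₀ : ℝ) (β : Coef p) : Matrix (Fin p) (Fin p) ℝ :=
  a₀ • info b D₀ β

/-- `Σ_g = [(1/n) ∑ b''(x_i'β) x_i x_i' + (a₀/n) ∑ b''(x_{0i}'β) x_{0i} x_{0i}']⁻¹`. -/
def sigmaG (b : ℝ → ℝ) (D D₀ : Data p) (a₀ : ℝ) (β : Coef p) : Matrix (Fin p) (Fin p) ℝ :=
  ((1 / (D.n : ℝ)) • info b D β + (a₀ / (D.n : ℝ)) • info b D₀ β)⁻¹

/-- `Σ_k = [(a₀/n) ∑ b''(x_{0i}'β) x_{0i} x_{0i}']⁻¹`. -/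
def sigmaK (b : ℝ → ℝ) (D D₀ : Data p) (a₀ : ℝ) (β : Coef p) : Matrix (Fin p) (Fin p) ℝ :=
  ((a₀ / (D.n : ℝ)) • info b D₀ β)⁻¹

/-- `π(a₀) · |Σ_g(βhat)|^{1/2} / |Σ_k(βtil)|^{1/2} · exp{-n [g_n(βhat) - k_n(βtil)]}`. -/
def laplaceKernel (q b : ℝ → ℝ) (π : ℝ → ℝ) (D D₀ : Data p) (βhat βtil : Coef p) (a₀ : ℝ) : ℝ :=
  π a₀ * (Real.sqrt (sigmaG b D D₀ a₀ βhat).det / Real.sqrt (sigmaK b D D₀ a₀ βtil).det) *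
    Real.exp (-(D.n : ℝ) * (g q b D D₀ a₀ βhat - k b D D₀ a₀ βtil))

/-- The regularity conditions of the Bayesian central limit theorem, uniformly in `a₀ ∈ K`, for a
sequence of posteriors with densities proportional to `lik m a₀ β * π₀ β`, where `J m a₀ β` is
minus the Hessian of `log (lik m a₀)` at `β` and `mode m a₀` is the maximizer of `lik m a₀`. -/
structure BayesCLT (K : Set ℝ) (π₀ : Coef p → ℝ) (lik : ℕ → ℝ → Coef p → ℝ)
    (J : ℕ → ℝ → Coef p → Matrix (Fin p) (Fin p) ℝ) (mode : ℕ → ℝ → Coef p) : Prop where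
  /-- The modes approach a compact set, at whose points `π₀` is positive and continuous. (If
  `K = {a₀}` and the modes converge to a point, this set can be taken to be that point.) -/
  modes_approach : ∃ M : Set (Coef p), IsCompact M ∧
    (∀ β ∈ M, ContinuousAt π₀ β ∧ 0 < π₀ β) ∧
    ∀ ρ > (0 : ℝ), ∀ᶠ m in atTop, ∀ a ∈ K, mode m a ∈ Metric.thickening ρ M
  /-- The smallest eigenvalue of `J` at the mode tends to infinity, that is, the largest eigenvalue
  of its inverse tends to `0`. -/
  steep : ∀ R : ℝ, ∀ᶠ m in atTop, ∀ a ∈ K,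
    (J m a (mode m a) - R • (1 : Matrix (Fin p) (Fin p) ℝ)).PosSemidef
  /-- `(1 - ε) J(mode) ≤ J(β) ≤ (1 + ε) J(mode)` in the Loewner order for `β` near the mode. -/
  smooth : ∀ ε > (0 : ℝ), ∃ ρ > (0 : ℝ), ∀ᶠ m in atTop, ∀ a ∈ K, ∀ β ∈ Metric.closedBall (mode m a) ρ,
    (J m a β - (1 - ε) • J m a (mode m a)).PosSemidef ∧
    ((1 + ε) • J m a (mode m a) - J m a β).PosSemidef
  /-- Either `π₀` is bounded, or the posterior mass outside every fixed neighbourhood of the mode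
  tends to `0`. -/
  consistent : (∃ B : ℝ, ∀ β, π₀ β ≤ B) ∨
    ∀ ρ > (0 : ℝ), ∀ ε > (0 : ℝ), ∀ᶠ m in atTop, ∀ a ∈ K,
      ∫ β in (Metric.closedBall (mode m a) ρ)ᶜ, lik m a β * π₀ β ≤
        ε * ∫ β, lik m a β * π₀ β

/-- `f_m(a) = h_m(a) (1 + o(1))` as `m → ∞`, uniformly in `a ∈ K`. -/
def AsympEqOn (K : Set ℝ) (f h : ℕ → ℝ → ℝ) : Prop :=
  ∀ ε > (0 : ℝ), ∀ᶠ m in atTop, ∀ a ∈ K, |f m a - h m a| ≤ ε * |h m a|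

end GLMPowerPrior

end

open GLMPowerPrior

/-! Write `f` for minus the log of a power likelihood. After integrating out `β`, the kernel of `a₀`
is `π(a₀)` times a quotient of two integrals of `e^{-f} π₀`: weight `w = 1` on the current data in
the numerator, `w = 0` in the denominator (`marginalKernel_eq`). Since `X'Y = X₀'Y₀`, `n g_n` and `n
k_n` are these two functions `f` up to the same additive constant `a₀ log Q(Y₀)` (`neg_mul_g_eq`,
`neg_mul_k_eq`). So `βhat` and `βtil` are the modes, and the constant cancels in `g_n - k_n`.

Each integral is asymptotic to `e^{-f(x)} π₀(x) / √det J(x)` times one and the same Gaussian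
integral, `x` being the mode (`tendsto_laplace_powerPosterior`). In the quotient the Gaussian
integrals cancel, as do the powers of `n` hidden in `Σ_g` and `Σ_k`; `C_n` is the inverse of the
normalizing integral over `a₀`.

Laplace's method is dominated convergence after the substitution `u = S v`, with `S'S = J(x)`. Near
the mode (C2) gives a quadratic lower bound for `f`; convexity, from `b'' > 0`, extends it to linear
growth far away. Uniformity in `a₀ ∈ K` is convergence along `atTop ×ˢ 𝓟 K` on pairs `(m, a₀)`, a
countably generated filter, to which dominated convergence applies. -/

/-! ### Laplace's method along a filter. -/

section Laplace

variable {E : Type*} [NormedAddCommGroup E] [NormedSpace ℝ E] [FiniteDimensional ℝ E]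
  [MeasurableSpace E] [BorelSpace E] (μ : Measure E) [μ.IsAddHaarMeasure]

/-- From `t^(d+1)/(d+1)! ≤ e^t` at `t = 1 + ‖u‖`, the function is dominated by a multiple of `(1 +
‖u‖)^(-(d+1))`, integrable in dimension `d`. -/
theorem integrable_exp_neg_norm : Integrable (fun u : E => Real.exp (-‖u‖)) μ := by
  set d := Module.finrank ℝ E
  have h : Integrable (fun u : E => ((d + 1).factorial * Real.exp 1) *
      (1 + ‖u‖) ^ (-((d + 1 : ℕ) : ℝ))) μ :=
    (integrable_one_add_norm (by push_cast; linarith)).const_mul _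
  refine h.mono' (by fun_prop) (Eventually.of_forall fun u => ?_)
  have h1 : (0 : ℝ) < 1 + ‖u‖ := by positivity
  have h2 := Real.pow_div_factorial_le_exp (1 + ‖u‖) h1.le (d + 1)
  rw [div_le_iff₀ (by positivity), Real.exp_add] at h2
  rw [Real.norm_eq_abs, Real.abs_exp, Real.rpow_neg h1.le, Real.rpow_natCast, Real.exp_neg,
    ← div_eq_mul_inv, inv_le_comm₀ (by positivity) (by positivity), inv_div,
    div_le_iff₀ (by positivity)]
  linarith

theorem integral_comp_symm_eq_abs_det_mul (S : E ≃L[ℝ] E) (F : E → ℝ) :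
    ∫ u, F (S.symm u) ∂μ = |LinearMap.det (S : E →ₗ[ℝ] E)| * ∫ v, F v ∂μ := by
  have hdet : LinearMap.det (S.symm : E →ₗ[ℝ] E) * LinearMap.det (S : E →ₗ[ℝ] E) = 1 :=
    LinearEquiv.det_symm_mul_det S.toLinearEquiv
  have h0 : LinearMap.det (S.symm : E →ₗ[ℝ] E) ≠ 0 := left_ne_zero_of_mul_eq_one hdet
  have hmap := Measure.map_linearMap_addHaar_eq_smul_addHaar μ h0
  have hemb : MeasurableEmbedding (S.symm : E →ₗ[ℝ] E) :=
    S.symm.toHomeomorph.measurableEmbedding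
  have := hemb.integral_map (μ := μ) F
  rw [hmap, integral_smul_measure, ENNReal.toReal_ofReal (abs_nonneg _),
    ← eq_inv_of_mul_eq_one_right hdet] at this
  exact this.symm

theorem exp_neg_sq_div_four_le (s : ℝ) : Real.exp (-(s ^ 2 / 4)) ≤ Real.exp 1 * Real.exp (-s) := by
  rw [← Real.exp_add, Real.exp_le_exp]
  nlinarith [sq_nonneg (s / 2 - 1)]

variable {ι : Type*} {l : Filter ι} [l.IsCountablyGenerated]

/-- The part of a Laplace integral that comes from a set of displacements of the mode on which
the prior is bounded. -/
theorem tendsto_laplace_setIntegral (f : ι → E → ℝ) (x : ι → E) (S : ι → E ≃L[ℝ] E) (φ : E → ℝ)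
    (hf : ∀ i, Continuous (f i)) (hφ : AEStronglyMeasurable φ μ) (hφ0 : ∀ y, 0 ≤ φ y)
    (hray : ∀ᶠ i in l, ∀ v, ∀ t ∈ Icc (0 : ℝ) 1,
      f i (x i + t • v) - f i (x i) ≤ t * (f i (x i + v) - f i (x i)))
    (hquad : ∀ ε > (0 : ℝ), ∃ ρ > (0 : ℝ), ∀ᶠ i in l, ∀ v, ‖v‖ ≤ ρ →
      (1 - ε) / 2 * ‖S i v‖ ^ 2 ≤ f i (x i + v) - f i (x i) ∧
      f i (x i + v) - f i (x i) ≤ (1 + ε) / 2 * ‖S i v‖ ^ 2)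
    (hsteep : ∀ R : ℝ, ∀ᶠ i in l, ∀ v, R * ‖v‖ ≤ ‖S i v‖)
    {κ : ℝ} (hκ : 0 < κ) (hφκ : ∀ᶠ i in l, κ ≤ φ (x i))
    (hφc : ∀ ε > (0 : ℝ), ∃ δ > (0 : ℝ), ∀ᶠ i in l, ∀ v, ‖v‖ < δ →
      |φ (x i + v) - φ (x i)| < ε)
    {W : Set E} (hW : MeasurableSet W) (hW0 : W ∈ 𝓝 (0 : E)) {B : ℝ}
    (hB : ∀ᶠ i in l, ∀ v ∈ W, φ (x i + v) ≤ B) :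
    Tendsto (fun i => (∫ v in W, Real.exp (-f i (x i + v)) * φ (x i + v) ∂μ) /
      (Real.exp (-f i (x i)) * φ (x i) / |LinearMap.det (S i : E →ₗ[ℝ] E)|)) l
      (𝓝 (∫ u, Real.exp (-(‖u‖ ^ 2 / 2)) ∂μ)) := by
  -- The integrand normalized by its value at the mode; the indicator of `W` lets the substitution
  -- run over the whole space.
  set Ψ : ι → E → ℝ := fun i v => W.indicator (fun v =>
    Real.exp (-(f i (x i + v) - f i (x i))) * (φ (x i + v) / φ (x i))) v with hΨ
  have key : Tendsto (fun i => ∫ u, Ψ i ((S i).symm u) ∂μ) l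
      (𝓝 (∫ u, Real.exp (-(‖u‖ ^ 2 / 2)) ∂μ)) := by
    have hB0 : ∀ᶠ i in l, 0 ≤ B := by
      filter_upwards [hB] with i hi
      exact (hφ0 _).trans (hi 0 (mem_of_mem_nhds hW0))
    refine tendsto_integral_filter_of_dominated_convergence
      (fun u => B / κ * (Real.exp 1 * Real.exp (-‖u‖))) (Eventually.of_forall fun i => ?_) ?_
      (((integrable_exp_neg_norm μ).const_mul _).const_mul _) (Eventually.of_forall fun u => ?_)
    · have h1 : AEStronglyMeasurable (Ψ i) μ := by
        refine AEStronglyMeasurable.indicator (AEStronglyMeasurable.mul ?_ ?_) hW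
        · have := hf i
          exact Continuous.aestronglyMeasurable (by fun_prop)
        · simp only [div_eq_mul_inv]
          exact (hφ.comp_quasiMeasurePreserving
            (measurePreserving_add_left μ (x i)).quasiMeasurePreserving).mul_const _
      refine h1.comp_quasiMeasurePreserving ⟨(S i).symm.continuous.measurable, ?_⟩
      have h0 : LinearMap.det ((S i).symm : E →ₗ[ℝ] E) ≠ 0 :=
        left_ne_zero_of_mul_eq_one (LinearEquiv.det_symm_mul_det (S i).toLinearEquiv)
      have hmap := Measure.map_linearMap_addHaar_eq_smul_addHaar μ h0
      have : Measure.map (⇑(S i).symm) μ = _ := hmap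
      rw [this]
      exact Measure.smul_absolutelyContinuous
    -- Domination. With `ε = 1/2` the increment of `f` is at least `‖S v‖²/4` for `‖v‖ ≤ ρ`;
    -- steepness `4/ρ` serves the range `‖v‖ > ρ`.
    · obtain ⟨ρ, hρ, hq⟩ := hquad (1 / 2) (by norm_num)
      filter_upwards [hray, hq, hsteep (4 / ρ), hφκ, hB, hB0] with
        i hray hq hst hφκ hB hB0
      refine Eventually.of_forall fun u => ?_
      obtain ⟨v, rfl⟩ := (S i).surjective u
      simp only [ContinuousLinearEquiv.symm_apply_apply]
      have hφi : 0 < φ (x i) := hκ.trans_le hφκ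
      by_cases hv : v ∈ W
      swap
      · simp only [hΨ, Set.indicator_of_notMem hv, norm_zero]
        positivity
      simp only [hΨ, Set.indicator_of_mem hv]
      rw [Real.norm_of_nonneg (mul_nonneg (Real.exp_pos _).le (div_nonneg (hφ0 _) hφi.le)), mul_comm]
      have hr : φ (x i + v) / φ (x i) ≤ B / κ :=
        div_le_div₀ hB0 (hB v hv) hκ hφκ
      refine mul_le_mul hr ?_ (Real.exp_pos _).le (by positivity)
      by_cases hvρ : ‖v‖ ≤ ρ
      · refine le_trans ?_ (exp_neg_sq_div_four_le _)
        rw [Real.exp_le_exp]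
        have := (hq v hvρ).1
        linarith
      -- Pull `v` back to the sphere of radius `ρ` by `t = ρ/‖v‖`. The quadratic bound there and
      -- convexity along the ray give an increment at `v` of at least `t‖S v‖²/4`, and `t‖S v‖ ≥ 4`
      -- by steepness, so the increment is at least `‖S v‖`.
      · push Not at hvρ
        have hv0 : 0 < ‖v‖ := hρ.trans hvρ
        have h1 := hray v (ρ / ‖v‖) ⟨by positivity, (div_le_one hv0).2 hvρ.le⟩
        have hn : ‖(ρ / ‖v‖) • v‖ = ρ := by
          rw [norm_smul, Real.norm_of_nonneg (by positivity), div_mul_cancel₀ _ hv0.ne']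
        have h2 := (hq ((ρ / ‖v‖) • v) hn.le).1
        rw [map_smul, norm_smul, Real.norm_of_nonneg (by positivity : 0 ≤ ρ / ‖v‖)] at h2
        have h3 := h2.trans h1
        have h4 : 0 < ρ / ‖v‖ := by positivity
        have h5 : (1 - 1 / 2) / 2 * ((ρ / ‖v‖) * ‖S i v‖ ^ 2) ≤ f i (x i + v) - f i (x i) := by
          refine le_of_mul_le_mul_left ?_ h4
          calc _ = (1 - 1 / 2) / 2 * (ρ / ‖v‖ * ‖S i v‖) ^ 2 := by ring
            _ ≤ _ := h3
        have h6 : 4 ≤ ρ / ‖v‖ * ‖S i v‖ := by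
          have := hst v
          rw [div_mul_eq_mul_div, le_div_iff₀ hv0]
          rw [div_mul_eq_mul_div, div_le_iff₀ hρ] at this
          linarith
        have h7 : ‖S i v‖ ≤ f i (x i + v) - f i (x i) := by
          nlinarith [norm_nonneg (S i v)]
        calc Real.exp (-(f i (x i + v) - f i (x i))) ≤ 1 * Real.exp (-‖S i v‖) := by
              rw [one_mul, Real.exp_le_exp]; linarith
          _ ≤ _ := by
              gcongr
              exact Real.one_le_exp (by norm_num)
    -- Pointwise convergence: for fixed `u`, steepness sends `S⁻¹u` to `0`, where the quadratic
    -- bounds and the continuity of `φ` apply.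
    · have hv0 : Tendsto (fun i => (S i).symm u) l (𝓝 0) := by
        rw [Metric.tendsto_nhds]
        intro ε hε
        filter_upwards [hsteep ((‖u‖ + 1) / ε)] with i hi
        have := hi ((S i).symm u)
        rw [ContinuousLinearEquiv.apply_symm_apply, div_mul_eq_mul_div, div_le_iff₀ hε] at this
        rw [dist_zero_right]
        have hu := norm_nonneg u
        by_contra! hc
        nlinarith
      have hsmall : ∀ δ > (0 : ℝ), ∀ᶠ i in l, ‖(S i).symm u‖ < δ := fun δ hδ => by
        simpa using (Metric.tendsto_nhds.1 hv0 δ hδ)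
      have hexp : Tendsto (fun i => f i (x i + (S i).symm u) - f i (x i)) l
          (𝓝 (‖u‖ ^ 2 / 2)) := by
        rw [Metric.tendsto_nhds]
        intro ε hε
        obtain ⟨ρ, hρ, hq⟩ := hquad (ε / (‖u‖ ^ 2 + 1)) (by positivity)
        filter_upwards [hq, hsmall ρ hρ] with i hi hs
        obtain ⟨h1, h2⟩ := hi _ hs.le
        rw [ContinuousLinearEquiv.apply_symm_apply] at h1 h2
        have h3 : ε / (‖u‖ ^ 2 + 1) * ‖u‖ ^ 2 ≤ ε := by
          rw [div_mul_eq_mul_div, div_le_iff₀ (by positivity)]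
          nlinarith
        rw [Real.dist_eq, abs_lt]
        constructor <;> nlinarith
      have hrat : Tendsto (fun i => φ (x i + (S i).symm u) / φ (x i)) l (𝓝 1) := by
        rw [Metric.tendsto_nhds]
        intro ε hε
        obtain ⟨δ, hδ, hc⟩ := hφc (ε * κ) (by positivity)
        filter_upwards [hc, hsmall δ hδ, hφκ] with i hi hs hk
        have hpos := hκ.trans_le hk
        rw [Real.dist_eq, div_sub_one hpos.ne', abs_div, abs_of_pos hpos, div_lt_iff₀ hpos]
        exact (hi _ hs).trans_le (by gcongr)
      have hlim := (Real.continuous_exp.continuousAt.tendsto.comp hexp.neg).mul hrat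
      rw [mul_one] at hlim
      refine hlim.congr' ?_
      filter_upwards [hv0.eventually hW0] with i hi
      simp only [hΨ, Set.indicator_of_mem (show (S i).symm u ∈ W from hi), Function.comp]
  refine key.congr fun i => ?_
  rw [integral_comp_symm_eq_abs_det_mul, hΨ, integral_indicator hW]
  have : ∀ v, Real.exp (-(f i (x i + v) - f i (x i))) * (φ (x i + v) / φ (x i)) =
      (Real.exp (-f i (x i + v)) * φ (x i + v)) * (Real.exp (-f i (x i)) * φ (x i))⁻¹ := by
    intro v
    rw [neg_sub, sub_eq_neg_add, Real.exp_add, mul_inv, ← Real.exp_neg (-f i (x i)), neg_neg]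
    ring
  simp only [this, integral_mul_const]
  rw [div_div_eq_mul_div]
  ring

/-- Laplace's method along a filter. -/
theorem tendsto_laplace_integral (f : ι → E → ℝ) (x : ι → E) (S : ι → E ≃L[ℝ] E) (φ : E → ℝ)
    (hf : ∀ i, Continuous (f i)) (hφ : AEStronglyMeasurable φ μ) (hφ0 : ∀ y, 0 ≤ φ y)
    (hint : ∀ᶠ i in l, Integrable (fun y => Real.exp (-f i y) * φ y) μ)
    (hray : ∀ᶠ i in l, ∀ v, ∀ t ∈ Icc (0 : ℝ) 1,
      f i (x i + t • v) - f i (x i) ≤ t * (f i (x i + v) - f i (x i)))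
    (hquad : ∀ ε > (0 : ℝ), ∃ ρ > (0 : ℝ), ∀ᶠ i in l, ∀ v, ‖v‖ ≤ ρ →
      (1 - ε) / 2 * ‖S i v‖ ^ 2 ≤ f i (x i + v) - f i (x i) ∧
      f i (x i + v) - f i (x i) ≤ (1 + ε) / 2 * ‖S i v‖ ^ 2)
    (hsteep : ∀ R : ℝ, ∀ᶠ i in l, ∀ v, R * ‖v‖ ≤ ‖S i v‖)
    {M : Set E} (hM : IsCompact M) (hφM : ∀ y ∈ M, ContinuousAt φ y ∧ 0 < φ y)
    (hx : ∀ ρ > (0 : ℝ), ∀ᶠ i in l, x i ∈ Metric.thickening ρ M)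
    (hcons : (∃ B : ℝ, ∀ y, φ y ≤ B) ∨ ∀ ρ > (0 : ℝ), ∀ ε > (0 : ℝ), ∀ᶠ i in l,
      ∫ y in (Metric.closedBall (x i) ρ)ᶜ, Real.exp (-f i y) * φ y ∂μ ≤
        ε * ∫ y, Real.exp (-f i y) * φ y ∂μ) :
    (∀ᶠ i in l, 0 < φ (x i)) ∧
    Tendsto (fun i => (∫ y, Real.exp (-f i y) * φ y ∂μ) /
      (Real.exp (-f i (x i)) * φ (x i) / |LinearMap.det (S i : E →ₗ[ℝ] E)|)) l
      (𝓝 (∫ u, Real.exp (-(‖u‖ ^ 2 / 2)) ∂μ)) := by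
  -- No point lies near an empty set, so in that case the filter is trivial.
  rcases M.eq_empty_or_nonempty with rfl | hMne
  · have : l = ⊥ := by
      have := hx 1 one_pos
      simpa [Metric.thickening_empty] using this
    simp [this]
  -- Compactness makes continuity uniform even though only one of the two points has to lie in `M`.
  have hunif : ∀ ε > (0 : ℝ), ∃ δ > (0 : ℝ), ∀ z ∈ M, ∀ y, dist z y < δ → |φ y - φ z| < ε := by
    intro ε hε
    have := hM.uniformContinuousAt_of_continuousAt φ (fun a ha => (hφM a ha).1)
      (Metric.dist_mem_uniformity hε)
    obtain ⟨δ, hδ, h⟩ := Metric.mem_uniformity_dist.1 this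
    refine ⟨δ, hδ, fun z hz y hzy => ?_⟩
    have := h hzy hz
    simpa [Real.dist_eq, abs_sub_comm] using this
  obtain ⟨z₀, hz₀, hmin⟩ := hM.exists_isMinOn hMne
    (fun y hy => (hφM y hy).1.continuousWithinAt)
  set κ := φ z₀ with hκdef
  have hκ : 0 < κ := (hφM z₀ hz₀).2
  have hφκ : ∀ᶠ i in l, κ / 2 ≤ φ (x i) := by
    obtain ⟨δ, hδ, h⟩ := hunif (κ / 2) (by positivity)
    filter_upwards [hx δ hδ] with i hi
    obtain ⟨z, hz, hd⟩ := Metric.mem_thickening_iff.1 hi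
    have h1 := (abs_lt.1 (h z hz (x i) (by rwa [dist_comm]))).1
    have h2 : κ ≤ φ z := hmin hz
    linarith
  have hφc : ∀ ε > (0 : ℝ), ∃ δ > (0 : ℝ), ∀ᶠ i in l, ∀ v, ‖v‖ < δ →
      |φ (x i + v) - φ (x i)| < ε := by
    intro ε hε
    obtain ⟨δ, hδ, h⟩ := hunif (ε / 2) (by positivity)
    refine ⟨δ / 2, by positivity, ?_⟩
    filter_upwards [hx (δ / 2) (by positivity)] with i hi v hv
    obtain ⟨z, hz, hd⟩ := Metric.mem_thickening_iff.1 hi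
    have h1 := abs_lt.1 (h z hz (x i) (by rw [dist_comm]; linarith))
    have h3 : dist z (x i + v) < δ := by
      calc dist z (x i + v) ≤ dist z (x i) + dist (x i) (x i + v) := dist_triangle _ _ _
        _ < δ := by rw [dist_comm, dist_self_add_right]; linarith
    have h2 := abs_lt.1 (h z hz _ h3)
    rw [abs_lt]
    constructor <;> linarith [h1.1, h1.2, h2.1, h2.2]
  refine ⟨hφκ.mono fun i hi => by linarith, ?_⟩
  rcases hcons with ⟨B, hB⟩ | hcons
  · have := tendsto_laplace_setIntegral μ f x S φ hf hφ hφ0 hray hquad hsteep (half_pos hκ) hφκ hφc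
      MeasurableSet.univ univ_mem (B := B) (Eventually.of_forall fun i v _ => hB _)
    refine this.congr fun i => ?_
    rw [setIntegral_univ, integral_add_left_eq_self (fun y => Real.exp (-f i y) * φ y)]
  -- If `φ` may be unbounded, it is still bounded near `M`: the set version applies on a small ball
  -- about the mode, and consistency makes the mass outside negligible.
  · obtain ⟨K, hK⟩ := (hM.image_of_continuousOn
      (fun y hy => (hφM y hy).1.continuousWithinAt)).isBounded.subset_closedBall 0
    obtain ⟨δ, hδ, hδc⟩ := hunif 1 one_pos
    have hbd : ∀ᶠ i in l, ∀ v ∈ Metric.closedBall (0 : E) (δ / 4), φ (x i + v) ≤ K + 1 := by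
      filter_upwards [hx (δ / 2) (by positivity)] with i hi v hv
      rw [mem_closedBall_zero_iff] at hv
      obtain ⟨z, hz, hd⟩ := Metric.mem_thickening_iff.1 hi
      have h3 : dist z (x i + v) < δ := by
        calc dist z (x i + v) ≤ dist z (x i) + dist (x i) (x i + v) := dist_triangle _ _ _
          _ < δ := by rw [dist_comm, dist_self_add_right]; linarith
      have h1 := abs_lt.1 (hδc z hz _ h3)
      have h2 : ‖φ z‖ ≤ K := by simpa using hK (mem_image_of_mem φ hz)
      have h4 := (le_abs_self (φ z)).trans h2
      linarith [h1.2]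
    have hlim := tendsto_laplace_setIntegral μ f x S φ hf hφ hφ0 hray hquad hsteep (half_pos hκ)
      hφκ hφc Metric.isClosed_closedBall.measurableSet
      (Metric.closedBall_mem_nhds 0 (by positivity : 0 < δ / 4)) hbd
    set I : ι → ℝ := fun i => ∫ y, Real.exp (-f i y) * φ y ∂μ with hI
    set I' : ι → ℝ := fun i => ∫ v in Metric.closedBall (0 : E) (δ / 4),
      Real.exp (-f i (x i + v)) * φ (x i + v) ∂μ with hI'
    have hball : ∀ i, I' i = ∫ y in Metric.closedBall (x i) (δ / 4),
        Real.exp (-f i y) * φ y ∂μ := by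
      intro i
      have hmp := (measurePreserving_add_left μ (x i)).setIntegral_preimage_emb
        (measurableEmbedding_addLeft (x i)) (fun y => Real.exp (-f i y) * φ y)
        (Metric.closedBall (x i) (δ / 4))
      rw [← hmp]
      simp [hI']
    have hI'I : ∀ᶠ i in l, I' i ≤ I i := by
      filter_upwards [hint] with i hi
      rw [hball]
      exact setIntegral_le_integral hi
        (Eventually.of_forall fun y => mul_nonneg (Real.exp_pos _).le (hφ0 y))
    have hI0 : ∀ i, 0 ≤ I' i := fun i =>
      integral_nonneg fun y => mul_nonneg (Real.exp_pos _).le (hφ0 _)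
    have hII' : ∀ ε > (0 : ℝ), ∀ᶠ i in l, I i - I' i ≤ ε * I i := by
      intro ε hε
      filter_upwards [hint, hcons (δ / 4) (by positivity) ε hε] with i hi hc
      have := integral_add_compl (Metric.isClosed_closedBall (x := x i)
        (ε := δ / 4)).measurableSet hi
      rw [← hball] at this
      simp only [hI] at hc ⊢
      linarith
    have hratio : Tendsto (fun i => 1 + (I i - I' i) / I' i) l (𝓝 (1 + 0)) := by
      refine tendsto_const_nhds.add ?_
      rw [Metric.tendsto_nhds]
      intro ε hε
      -- `η ≤ 1/2` gives `I ≤ 2 I'`, whence `I - I' ≤ 2 η I' ≤ (ε/2) I'`.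
      set η := min (1 / 2) (ε / 4) with hη
      have hη0 : 0 < η := by positivity
      filter_upwards [hII' η hη0, hI'I] with i h1 h2
      rw [Real.dist_eq, sub_zero, abs_of_nonneg (div_nonneg (by linarith) (hI0 i))]
      rcases (hI0 i).eq_or_lt with h0 | h0
      · rw [← h0]; simpa using hε
      · rw [div_lt_iff₀ h0]
        have h3 : η ≤ 1 / 2 := min_le_left _ _
        have h4 : η ≤ ε / 4 := min_le_right _ _
        have h5 : I i ≤ 2 * I' i := by nlinarith
        nlinarith
    rw [add_zero] at hratio
    have := hlim.mul hratio
    rw [mul_one] at this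
    refine this.congr' ?_
    filter_upwards [hII' (1 / 2) (by norm_num), hI'I] with i h1 h2
    change I' i / _ * _ = I i / _
    rcases (hI0 i).eq_or_lt with h0 | h0
    · have : I i = 0 := by
        rw [← h0] at h1 h2
        linarith
      simp [this, ← h0]
    · field_simp
      ring

end Laplace

/-! ### Second-order bounds on the unit interval. -/

section Calculus

/-- Monotonicity is used twice: `φ' - M t` decreases, so `φ' ≤ M t`, hence `φ - M t²/2` decreases.
-/
theorem sub_le_half_of_second_deriv_le {φ φ' φ'' : ℝ → ℝ} (h1 : ∀ t, HasDerivAt φ (φ' t) t)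
    (h2 : ∀ t, HasDerivAt φ' (φ'' t) t) (h0 : φ' 0 = 0) {M : ℝ}
    (hM : ∀ t ∈ Icc (0 : ℝ) 1, φ'' t ≤ M) : φ 1 - φ 0 ≤ M / 2 := by
  have step1 : AntitoneOn (fun t => φ' t - M * t) (Icc 0 1) := by
    have hd : ∀ t, HasDerivAt (fun t => φ' t - M * t) (φ'' t - M) t := fun t =>
      ((h2 t).sub ((hasDerivAt_id t).const_mul M)).congr_deriv (by rw [mul_one])
    refine antitoneOn_of_deriv_nonpos (convex_Icc 0 1)
      (fun t _ => (hd t).continuousAt.continuousWithinAt)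
      (fun t _ => (hd t).differentiableAt.differentiableWithinAt) fun t ht => ?_
    rw [(hd t).deriv]
    linarith [hM t (interior_subset ht)]
  have step2 : AntitoneOn (fun t => φ t - M / 2 * t ^ 2) (Icc 0 1) := by
    have hd : ∀ t, HasDerivAt (fun t => φ t - M / 2 * t ^ 2) (φ' t - M * t) t := fun t =>
      ((h1 t).sub ((hasDerivAt_pow 2 t).const_mul (M / 2))).congr_deriv (by norm_num; ring)
    refine antitoneOn_of_deriv_nonpos (convex_Icc 0 1)
      (fun t _ => (hd t).continuousAt.continuousWithinAt)
      (fun t _ => (hd t).differentiableAt.differentiableWithinAt) fun t ht => ?_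
    rw [(hd t).deriv]
    have ht' := interior_subset ht
    simpa [h0] using step1 (left_mem_Icc.2 zero_le_one) ht' ht'.1
  have := step2 (left_mem_Icc.2 zero_le_one) (right_mem_Icc.2 zero_le_one) zero_le_one
  norm_num at this
  linarith

theorem half_le_sub_of_le_second_deriv {φ φ' φ'' : ℝ → ℝ} (h1 : ∀ t, HasDerivAt φ (φ' t) t)
    (h2 : ∀ t, HasDerivAt φ' (φ'' t) t) (h0 : φ' 0 = 0) {M : ℝ}
    (hM : ∀ t ∈ Icc (0 : ℝ) 1, M ≤ φ'' t) : M / 2 ≤ φ 1 - φ 0 := by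
  have := sub_le_half_of_second_deriv_le (fun t => (h1 t).neg) (fun t => (h2 t).neg)
    (by simp [h0]) (M := -M) fun t ht => neg_le_neg (hM t ht)
  simp only [Pi.neg_apply] at this
  linarith

end Calculus

/-! ### Positive definite matrices as squared norms. -/

section QuadraticForm

variable {p : ℕ}

/-- Factor `A = BᴴB` and let `S` be the map of `B`; it is invertible because `(det B)² = det A > 0`.
-/
theorem exists_equiv_of_posDef {A : Matrix (Fin p) (Fin p) ℝ} (hA : A.PosDef) :
    ∃ S : Coef p ≃L[ℝ] Coef p,
      (∀ v : Coef p, ‖S v‖ ^ 2 = v.ofLp ⬝ᵥ A *ᵥ v.ofLp) ∧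
      |LinearMap.det (S : Coef p →ₗ[ℝ] Coef p)| = √A.det := by
  obtain ⟨B, rfl⟩ : ∃ B : Matrix (Fin p) (Fin p) ℝ, A = Bᴴ * B := by
    open scoped MatrixOrder in
    exact CStarAlgebra.nonneg_iff_eq_star_mul_self.1 hA.posSemidef.nonneg
  have hdet : (Bᴴ * B).det = B.det ^ 2 := by
    rw [det_mul, det_conjTranspose, star_trivial, sq]
  have hB : B.det ≠ 0 := fun h => by
    have := hA.det_pos
    rw [hdet, h] at this
    simp at this
  have hL : LinearMap.det (Matrix.toLpLin 2 2 B) = B.det := by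
    rw [Matrix.toLpLin_eq_toLin, LinearMap.det_toLin]
  refine ⟨(LinearMap.equivOfDetNeZero (Matrix.toLpLin 2 2 B)
    (by rwa [hL])).toContinuousLinearEquiv, fun v => ?_, ?_⟩
  · change ‖Matrix.toLpLin 2 2 B v‖ ^ 2 = _
    rw [EuclideanSpace.real_norm_sq_eq, ← mulVec_mulVec, dotProduct_mulVec,
      conjTranspose_eq_transpose_of_trivial, vecMul_transpose]
    simp [dotProduct, sq]
  · change |LinearMap.det (Matrix.toLpLin 2 2 B)| = _
    rw [hL, hdet, Real.sqrt_sq_eq_abs]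

theorem dotProduct_le_of_posSemidef_sub {A B : Matrix (Fin p) (Fin p) ℝ} (h : (A - B).PosSemidef)
    (v : Fin p → ℝ) : v ⬝ᵥ B *ᵥ v ≤ v ⬝ᵥ A *ᵥ v := by
  have := h.dotProduct_mulVec_nonneg v
  rw [sub_mulVec, dotProduct_sub, star_trivial] at this
  linarith

end QuadraticForm

/-! ### Derivatives, convexity and local quadratic bounds of the log-likelihood. -/

section GLM

variable {p : ℕ} {q b : ℝ → ℝ} {D D₀ : Data p}

theorem GLMPowerPrior.Data.linPred_add_smul (D : Data p) (i : Fin D.n) (x v : Coef p) (t : ℝ) :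
    D.linPred i (x + t • v) = D.linPred i x + t * D.linPred i v := by
  simp only [Data.linPred, PiLp.add_apply, PiLp.smul_apply, smul_eq_mul, Finset.mul_sum,
    ← Finset.sum_add_distrib]
  exact Finset.sum_congr rfl fun j _ => by ring

theorem GLMPowerPrior.Data.continuous_linPred (D : Data p) (i : Fin D.n) :
    Continuous (D.linPred i) := by
  unfold Data.linPred
  fun_prop

theorem dotProduct_info (b : ℝ → ℝ) (D : Data p) (β v : Coef p) :
    v.ofLp ⬝ᵥ info b D β *ᵥ v.ofLp =
      ∑ i, deriv (deriv b) (D.linPred i β) * D.linPred i v ^ 2 := by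
  unfold info
  rw [sum_mulVec, dotProduct_sum]
  refine Finset.sum_congr rfl fun i _ => ?_
  rw [smul_mulVec, dotProduct_smul, vecMulVec_mulVec, dotProduct_smul, smul_eq_mul]
  simp only [Data.linPred, dotProduct, sq, op_smul_eq_smul, smul_eq_mul]
  congr 2
  exact Finset.sum_congr rfl fun j _ => mul_comm _ _

/-- The negative log-likelihood. -/
noncomputable def negLogLik (q b : ℝ → ℝ) (D : Data p) (β : Coef p) : ℝ :=
  -Real.log (likelihood q b D β)

theorem likelihood_pos (hq : ∀ i, 0 < q (D.Y i)) (β : Coef p) : 0 < likelihood q b D β :=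
  Finset.prod_pos fun i _ => mul_pos (hq i) (Real.exp_pos _)

theorem likelihood_eq_exp (hq : ∀ i, 0 < q (D.Y i)) (β : Coef p) :
    likelihood q b D β = Real.exp (-negLogLik q b D β) := by
  rw [negLogLik, neg_neg, Real.exp_log (likelihood_pos hq β)]

theorem likelihood_rpow_eq_exp (hq : ∀ i, 0 < q (D.Y i)) (β : Coef p) (a : ℝ) :
    likelihood q b D β ^ a = Real.exp (-(a * negLogLik q b D β)) := by
  rw [likelihood_eq_exp hq, ← Real.exp_mul]
  ring_nf

theorem negLogLik_eq (hq : ∀ i, 0 < q (D.Y i)) (β : Coef p) :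
    negLogLik q b D β = -Real.log (D.Q q) +
      (∑ i, b (D.linPred i β) - ∑ i, D.Y i * D.linPred i β) := by
  rw [negLogLik, likelihood, Finset.prod_mul_distrib, ← Real.exp_sum, Real.log_mul
    (Finset.prod_pos fun i _ => hq i).ne' (Real.exp_pos _).ne', Real.log_exp,
    Finset.sum_sub_distrib, Data.Q]
  ring

theorem continuous_negLogLik (hb : ContDiff ℝ 2 b) (hq : ∀ i, 0 < q (D.Y i)) :
    Continuous (negLogLik q b D) := by
  rw [funext (negLogLik_eq hq)]
  have h1 := D.continuous_linPred
  have h2 := hb.continuous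
  fun_prop

/-- The derivative of the negative log-likelihood at `β` in the direction `v`. -/
noncomputable def scoreAlong (b : ℝ → ℝ) (D : Data p) (β v : Coef p) : ℝ :=
  ∑ i, (deriv b (D.linPred i β) * D.linPred i v - D.Y i * D.linPred i v)

theorem hasDerivAt_linPred_line (D : Data p) (i : Fin D.n) (x v : Coef p) (t : ℝ) :
    HasDerivAt (fun t : ℝ => D.linPred i (x + t • v)) (D.linPred i v) t := by
  simp only [Data.linPred_add_smul]
  simpa using ((hasDerivAt_id t).mul_const (D.linPred i v)).const_add (D.linPred i x)

theorem hasDerivAt_negLogLik_line (hb : ContDiff ℝ 2 b) (hq : ∀ i, 0 < q (D.Y i))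
    (x v : Coef p) (t : ℝ) :
    HasDerivAt (fun t : ℝ => negLogLik q b D (x + t • v)) (scoreAlong b D (x + t • v) v) t := by
  simp only [negLogLik_eq hq, ← Finset.sum_sub_distrib]
  refine HasDerivAt.const_add _ (HasDerivAt.fun_sum fun i _ => ?_)
  have hlin := hasDerivAt_linPred_line D i x v t
  have hbd : HasDerivAt b (deriv b (D.linPred i (x + t • v))) (D.linPred i (x + t • v)) :=
    (hb.differentiable (by norm_num) _).hasDerivAt
  exact (hbd.comp t hlin).sub (hlin.const_mul _)

theorem hasDerivAt_scoreAlong_line (hb : ContDiff ℝ 2 b) (x v : Coef p) (t : ℝ) :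
    HasDerivAt (fun t : ℝ => scoreAlong b D (x + t • v) v)
      (v.ofLp ⬝ᵥ info b D (x + t • v) *ᵥ v.ofLp) t := by
  rw [dotProduct_info]
  refine HasDerivAt.fun_sum fun i _ => ?_
  have hlin := hasDerivAt_linPred_line D i x v t
  have hb' : Differentiable ℝ (deriv b) := by
    have : ContDiff ℝ 1 (deriv b) := ((contDiff_succ_iff_deriv (n := 1)).1 hb).2.2
    exact this.differentiable (by norm_num)
  have := ((hb' (D.linPred i (x + t • v))).hasDerivAt.comp t hlin).mul_const (D.linPred i v)
  rw [mul_assoc, ← sq] at this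
  exact this.sub_const _

/-- The weighted sum of the negative log-likelihoods of two data sets. -/
noncomputable def powerNegLogLik (q b : ℝ → ℝ) (D D₀ : Data p) (w a : ℝ) (β : Coef p) : ℝ :=
  w * negLogLik q b D β + a * negLogLik q b D₀ β

/-- The Hessian of `powerNegLogLik`. -/
noncomputable def powerInfo (b : ℝ → ℝ) (D D₀ : Data p) (w a : ℝ) (β : Coef p) :
    Matrix (Fin p) (Fin p) ℝ :=
  w • info b D β + a • info b D₀ β

theorem continuous_powerNegLogLik (hb : ContDiff ℝ 2 b) (hq : ∀ i, 0 < q (D.Y i))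
    (hq₀ : ∀ i, 0 < q (D₀.Y i)) (w a : ℝ) :
    Continuous (powerNegLogLik q b D D₀ w a) := by
  have h1 := continuous_negLogLik hb hq
  have h2 := continuous_negLogLik hb hq₀
  unfold powerNegLogLik
  fun_prop

theorem hasDerivAt_powerNegLogLik_line (hb : ContDiff ℝ 2 b) (hq : ∀ i, 0 < q (D.Y i))
    (hq₀ : ∀ i, 0 < q (D₀.Y i))
    (w a : ℝ) (x v : Coef p) (t : ℝ) :
    HasDerivAt (fun t : ℝ => powerNegLogLik q b D D₀ w a (x + t • v))
      (w * scoreAlong b D (x + t • v) v + a * scoreAlong b D₀ (x + t • v) v) t :=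
  ((hasDerivAt_negLogLik_line hb hq x v t).const_mul w).add
    ((hasDerivAt_negLogLik_line hb hq₀ x v t).const_mul a)

theorem hasDerivAt_powerScore_line (hb : ContDiff ℝ 2 b) (w a : ℝ) (x v : Coef p) (t : ℝ) :
    HasDerivAt (fun t : ℝ => w * scoreAlong b D (x + t • v) v + a * scoreAlong b D₀ (x + t • v) v)
      (v.ofLp ⬝ᵥ powerInfo b D D₀ w a (x + t • v) *ᵥ v.ofLp) t := by
  have := ((hasDerivAt_scoreAlong_line (D := D) hb x v t).const_mul w).add
    ((hasDerivAt_scoreAlong_line (D := D₀) hb x v t).const_mul a)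
  rw [powerInfo, add_mulVec, dotProduct_add, smul_mulVec, smul_mulVec, dotProduct_smul,
    dotProduct_smul]
  exact this

/-- This is convexity on a segment: the second derivative along `v` is a nonnegative combination of
the terms `b''(x_i'β) (x_i'v)²`. -/
theorem powerNegLogLik_ray_le (hb : ContDiff ℝ 2 b) (hq : ∀ i, 0 < q (D.Y i))
    (hq₀ : ∀ i, 0 < q (D₀.Y i))
    (hb'' : ∀ t, 0 < deriv (deriv b) t) {w a : ℝ} (hw : 0 ≤ w)
    (ha : 0 ≤ a) (x v : Coef p) {t : ℝ} (ht : t ∈ Icc (0 : ℝ) 1) :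
    powerNegLogLik q b D D₀ w a (x + t • v) - powerNegLogLik q b D D₀ w a x ≤
      t * (powerNegLogLik q b D D₀ w a (x + v) - powerNegLogLik q b D D₀ w a x) := by
  have h1 := hasDerivAt_powerNegLogLik_line hb hq hq₀ w a x v
  have h2 := hasDerivAt_powerScore_line (D := D) (D₀ := D₀) hb w a x v
  have hinfo : ∀ (D : Data p) (β : Coef p), 0 ≤ v.ofLp ⬝ᵥ info b D β *ᵥ v.ofLp := fun D β => by
    rw [dotProduct_info]
    exact Finset.sum_nonneg fun i _ => mul_nonneg (hb'' _).le (sq_nonneg _)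
  have hmono : Monotone (deriv fun t : ℝ => powerNegLogLik q b D D₀ w a (x + t • v)) := by
    rw [funext fun t => (h1 t).deriv]
    refine monotone_of_deriv_nonneg (fun t => (h2 t).differentiableAt) fun t => ?_
    rw [(h2 t).deriv, powerInfo, add_mulVec, dotProduct_add, smul_mulVec, smul_mulVec,
      dotProduct_smul, dotProduct_smul]
    exact add_nonneg (mul_nonneg hw (hinfo _ _)) (mul_nonneg ha (hinfo _ _))
  have hconv := hmono.convexOn_univ_of_deriv fun t => (h1 t).differentiableAt
  have := hconv.2 (mem_univ 0) (mem_univ 1) (sub_nonneg.2 ht.2) ht.1 (by ring)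
  simp only [smul_eq_mul, mul_zero, mul_one, zero_add, zero_smul, add_zero, one_smul] at this
  linarith

/-- At a minimizer the first-order term vanishes, and the Loewner bounds control the second
derivative on the segment from `x` to `x + v`. -/
theorem powerNegLogLik_sub_bounds (hb : ContDiff ℝ 2 b) (hq : ∀ i, 0 < q (D.Y i))
    (hq₀ : ∀ i, 0 < q (D₀.Y i))
    {w a : ℝ} {x v : Coef p}
    (hmin : ∀ y, powerNegLogLik q b D D₀ w a x ≤ powerNegLogLik q b D D₀ w a y) {ε ρ : ℝ}
    (hv : ‖v‖ ≤ ρ)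
    (hJ : ∀ β ∈ Metric.closedBall x ρ,
      (powerInfo b D D₀ w a β - (1 - ε) • powerInfo b D D₀ w a x).PosSemidef ∧
      ((1 + ε) • powerInfo b D D₀ w a x - powerInfo b D D₀ w a β).PosSemidef) :
    (1 - ε) / 2 * (v.ofLp ⬝ᵥ powerInfo b D D₀ w a x *ᵥ v.ofLp) ≤
        powerNegLogLik q b D D₀ w a (x + v) - powerNegLogLik q b D D₀ w a x ∧
      powerNegLogLik q b D D₀ w a (x + v) - powerNegLogLik q b D D₀ w a x ≤
        (1 + ε) / 2 * (v.ofLp ⬝ᵥ powerInfo b D D₀ w a x *ᵥ v.ofLp) := by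
  have h1 := hasDerivAt_powerNegLogLik_line hb hq hq₀ w a x v
  have h2 := hasDerivAt_powerScore_line (D := D) (D₀ := D₀) hb w a x v
  have h0 := (show IsLocalMin (fun t : ℝ => powerNegLogLik q b D D₀ w a (x + t • v)) 0 from
    Eventually.of_forall fun t => by simpa using hmin (x + t • v)).hasDerivAt_eq_zero (h1 0)
  have hmem : ∀ t ∈ Icc (0 : ℝ) 1, x + t • v ∈ Metric.closedBall x ρ := fun t ht => by
    rw [mem_closedBall_iff_norm, add_sub_cancel_left, norm_smul, Real.norm_of_nonneg ht.1]
    exact (mul_le_of_le_one_left (norm_nonneg v) ht.2).trans hv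
  have hlo := half_le_sub_of_le_second_deriv h1 h2 h0
    (M := (1 - ε) * (v.ofLp ⬝ᵥ powerInfo b D D₀ w a x *ᵥ v.ofLp)) fun t ht => by
      have := dotProduct_le_of_posSemidef_sub (hJ _ (hmem t ht)).1 v.ofLp
      rwa [smul_mulVec, dotProduct_smul] at this
  have hhi := sub_le_half_of_second_deriv_le h1 h2 h0
    (M := (1 + ε) * (v.ofLp ⬝ᵥ powerInfo b D D₀ w a x *ᵥ v.ofLp)) fun t ht => by
      have := dotProduct_le_of_posSemidef_sub (hJ _ (hmem t ht)).2 v.ofLp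
      rwa [smul_mulVec, dotProduct_smul] at this
  simp only [one_smul, zero_smul, add_zero] at hlo hhi
  constructor <;> linarith

end GLM

/-! ### Application to the power posteriors and the marginal of `a₀`. -/

section Posterior

variable {p : ℕ} {q b : ℝ → ℝ} {π₀ : Coef p → ℝ} {π : ℝ → ℝ}

/-- Multiplying the integrand by the continuous `e^f` recovers `φ`; measurability of `π₀` thus
follows from propriety. -/
theorem aestronglyMeasurable_of_integrable_exp_neg_mul {f φ : Coef p → ℝ} (hf : Continuous f)
    (hint : Integrable fun β => Real.exp (-f β) * φ β) : AEStronglyMeasurable φ volume := by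
  have h := ((Real.continuous_exp.comp hf).aestronglyMeasurable (μ := volume)).mul
    hint.aestronglyMeasurable
  refine h.congr (Eventually.of_forall fun β => ?_)
  simp only [Pi.mul_apply, Function.comp, ← mul_assoc, ← Real.exp_add, add_neg_cancel,
    Real.exp_zero, one_mul]

theorem integral_mul_pos_of_continuousAt {f φ : Coef p → ℝ} (hf : ∀ β, 0 < f β)
    (hφ : ∀ β, 0 ≤ φ β) {z : Coef p} (hz : ContinuousAt φ z) (hz0 : 0 < φ z)
    (hint : Integrable fun β => f β * φ β) : 0 < ∫ β, f β * φ β := by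
  rw [integral_pos_iff_support_of_nonneg (fun β => mul_nonneg (hf β).le (hφ β)) hint]
  refine Measure.measure_pos_of_mem_nhds volume (x := z) ?_
  filter_upwards [hz.eventually (lt_mem_nhds hz0)] with β hβ
  exact (mul_pos (hf β) hβ).ne'

theorem GLMPowerPrior.BayesCLT.exists_continuousAt_pos {K : Set ℝ} {lik : ℕ → ℝ → Coef p → ℝ}
    {J : ℕ → ℝ → Coef p → Matrix (Fin p) (Fin p) ℝ} {mode : ℕ → ℝ → Coef p}
    (h : BayesCLT K π₀ lik J mode) (hK : K.Nonempty) : ∃ z, ContinuousAt π₀ z ∧ 0 < π₀ z := by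
  obtain ⟨M, -, hM, hx⟩ := h.modes_approach
  obtain ⟨m, hm⟩ := (hx 1 one_pos).exists
  obtain ⟨a, ha⟩ := hK
  obtain ⟨z, hz, -⟩ := Metric.mem_thickening_iff.1 (hm a ha)
  exact ⟨z, hM z hz⟩

/-- The integral of a power posterior divided by its Laplace approximation around `x`, up to the
factor `(2π)^(p/2)`. -/
noncomputable def laplaceRatio (q b : ℝ → ℝ) (π₀ : Coef p → ℝ) (D D₀ : Data p) (w a : ℝ)
    (x : Coef p) : ℝ :=
  (∫ β, Real.exp (-powerNegLogLik q b D D₀ w a β) * π₀ β) /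
    (Real.exp (-powerNegLogLik q b D D₀ w a x) * π₀ x / √(powerInfo b D D₀ w a x).det)

/-- Laplace's method for the power posteriors, uniformly in the power. -/
theorem tendsto_laplace_powerPosterior {K : Set ℝ} (hK : ∀ a ∈ K, 0 ≤ a) {w : ℝ} (hw : 0 ≤ w)
    {D D₀ : ℕ → Data p} {mode : ℕ → ℝ → Coef p}
    (hb : ContDiff ℝ 2 b) (hb'' : ∀ t, 0 < deriv (deriv b) t)
    (hq : ∀ m i, 0 < q ((D m).Y i)) (hq₀ : ∀ m i, 0 < q ((D₀ m).Y i))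
    (hπ₀ : ∀ β, 0 ≤ π₀ β) (hπ₀m : AEStronglyMeasurable π₀ volume)
    (hint : ∀ m, ∀ a ∈ K,
      Integrable fun β => Real.exp (-powerNegLogLik q b (D m) (D₀ m) w a β) * π₀ β)
    (hmin : ∀ᶠ m in atTop, ∀ a ∈ K, ∀ β, powerNegLogLik q b (D m) (D₀ m) w a (mode m a) ≤
      powerNegLogLik q b (D m) (D₀ m) w a β)
    (hreg : BayesCLT K π₀ (fun m a β => Real.exp (-powerNegLogLik q b (D m) (D₀ m) w a β))
      (fun m a β => powerInfo b (D m) (D₀ m) w a β) mode) :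
    (∀ᶠ i in atTop ×ˢ 𝓟 K, 0 < π₀ (mode i.1 i.2)) ∧
    (∀ᶠ i in atTop ×ˢ 𝓟 K, 0 < (powerInfo b (D i.1) (D₀ i.1) w i.2 (mode i.1 i.2)).det) ∧
    Tendsto (fun i : ℕ × ℝ => laplaceRatio q b π₀ (D i.1) (D₀ i.1) w i.2 (mode i.1 i.2))
      (atTop ×ˢ 𝓟 K) (𝓝 (∫ u : Coef p, Real.exp (-(‖u‖ ^ 2 / 2)))) := by
  obtain ⟨M, hM, hφM, hx⟩ := hreg.modes_approach
  set A : ℕ × ℝ → Matrix (Fin p) (Fin p) ℝ := fun i =>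
    powerInfo b (D i.1) (D₀ i.1) w i.2 (mode i.1 i.2) with hA
  have hpd : ∀ᶠ i in atTop ×ˢ 𝓟 K, (A i).PosDef := by
    rw [eventually_prod_principal_iff]
    filter_upwards [hreg.steep 1] with m hm a ha
    simpa using PosDef.one.posSemidef_add (hm a ha)
  -- The Hessian is only eventually positive definite; elsewhere `S` is the identity as a filler.
  have hS : ∀ i, ∃ S : Coef p ≃L[ℝ] Coef p, (A i).PosDef →
      (∀ v : Coef p, ‖S v‖ ^ 2 = v.ofLp ⬝ᵥ A i *ᵥ v.ofLp) ∧
      |LinearMap.det (S : Coef p →ₗ[ℝ] Coef p)| = √(A i).det := fun i => by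
    by_cases h : (A i).PosDef
    · obtain ⟨S, hS⟩ := exists_equiv_of_posDef h
      exact ⟨S, fun _ => hS⟩
    · exact ⟨ContinuousLinearEquiv.refl ℝ _, fun h' => absurd h' h⟩
  choose S hS using hS
  have hKl : ∀ᶠ i : ℕ × ℝ in atTop ×ˢ 𝓟 K, i.2 ∈ K := by
    rw [eventually_prod_principal_iff]
    exact Eventually.of_forall fun m a ha => ha
  obtain ⟨hpos, hlim⟩ := tendsto_laplace_integral (l := atTop ×ˢ 𝓟 K) volume
    (fun i => powerNegLogLik q b (D i.1) (D₀ i.1) w i.2) (fun i => mode i.1 i.2) S π₀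
    (fun i => continuous_powerNegLogLik hb (hq _) (hq₀ _) _ _) hπ₀m hπ₀
    (hKl.mono fun i hi => hint i.1 i.2 hi)
    (hKl.mono fun i hi v t ht =>
      powerNegLogLik_ray_le hb (hq _) (hq₀ _) hb'' hw (hK _ hi) _ v ht)
    (fun ε hε => by
      obtain ⟨ρ, hρ, h⟩ := hreg.smooth ε hε
      refine ⟨ρ, hρ, ?_⟩
      rw [eventually_prod_principal_iff] at hpd ⊢
      filter_upwards [h, hmin, hpd] with m hJ hmin hpd a ha v hv
      rw [(hS (m, a) (hpd a ha)).1]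
      exact powerNegLogLik_sub_bounds hb (hq _) (hq₀ _) (hmin a ha) hv (hJ a ha))
    (fun R => by
      -- The square of `R` enters because `‖S v‖²` is the quadratic form of `A`.
      have h' : ∀ᶠ i in atTop ×ˢ 𝓟 K, (A i - R ^ 2 • 1).PosSemidef :=
        eventually_prod_principal_iff.2 (hreg.steep (R ^ 2))
      filter_upwards [h', hpd] with i hi hpd v
      refine le_of_sq_le_sq ?_ (norm_nonneg _)
      rw [(hS i hpd).1, mul_pow]
      refine le_trans (le_of_eq ?_) (dotProduct_le_of_posSemidef_sub hi v.ofLp)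
      rw [smul_mulVec, one_mulVec, dotProduct_smul, EuclideanSpace.real_norm_sq_eq]
      simp [dotProduct, sq])
    hM hφM (fun ρ hρ => eventually_prod_principal_iff.2 (hx ρ hρ))
    (hreg.consistent.imp_right fun h ρ hρ ε hε => eventually_prod_principal_iff.2 (h ρ hρ ε hε))
  refine ⟨hpos, hpd.mono fun i hi => hi.det_pos, hlim.congr' ?_⟩
  filter_upwards [hpd] with i hi
  rw [(hS i hi).2, laplaceRatio]

variable {D D₀ : Data p}

theorem sum_response_mul_linPred_eq (hXY : D.Xᵀ *ᵥ D.Y = D₀.Xᵀ *ᵥ D₀.Y) (β : Coef p) :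
    ∑ i, D.Y i * D.linPred i β = ∑ i, D₀.Y i * D₀.linPred i β := by
  have h : ∀ D : Data p, ∑ i, D.Y i * D.linPred i β = (D.Xᵀ *ᵥ D.Y) ⬝ᵥ β.ofLp := fun D => by
    rw [mulVec_transpose, ← dotProduct_mulVec]
    rfl
  rw [h, h, hXY]

theorem neg_mul_g_eq (hn : 0 < D.n) (hq : ∀ i, 0 < q (D.Y i)) (hq₀ : ∀ i, 0 < q (D₀.Y i))
    (hXY : D.Xᵀ *ᵥ D.Y = D₀.Xᵀ *ᵥ D₀.Y) (a : ℝ) (β : Coef p) :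
    -(D.n : ℝ) * g q b D D₀ a β =
      -powerNegLogLik q b D D₀ 1 a β - a * Real.log (D₀.Q q) := by
  have hn' : (D.n : ℝ) ≠ 0 := by positivity
  rw [powerNegLogLik, negLogLik_eq hq, negLogLik_eq hq₀, g, sum_response_mul_linPred_eq hXY]
  field_simp
  ring

theorem neg_mul_k_eq (hn : 0 < D.n) (hq : ∀ i, 0 < q (D.Y i)) (hq₀ : ∀ i, 0 < q (D₀.Y i))
    (hXY : D.Xᵀ *ᵥ D.Y = D₀.Xᵀ *ᵥ D₀.Y) (a : ℝ) (β : Coef p) :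
    -(D.n : ℝ) * k b D D₀ a β =
      -powerNegLogLik q b D D₀ 0 a β - a * Real.log (D₀.Q q) := by
  have hn' : (D.n : ℝ) ≠ 0 := by positivity
  rw [powerNegLogLik, negLogLik_eq hq, negLogLik_eq hq₀, k, sum_response_mul_linPred_eq hXY]
  field_simp
  ring

theorem sqrt_det_inv_smul {n : ℕ} (c : ℝ) (hc : 0 ≤ c) (A : Matrix (Fin n) (Fin n) ℝ) :
    √((c • A)⁻¹).det = (√(c ^ n))⁻¹ * (√A.det)⁻¹ := by
  rw [det_nonsing_inv, Ring.inverse_eq_inv', det_smul, Fintype.card_fin, Real.sqrt_inv,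
    Real.sqrt_mul (by positivity), mul_inv]

theorem laplaceKernel_eq (hn : 0 < D.n) (hq : ∀ i, 0 < q (D.Y i)) (hq₀ : ∀ i, 0 < q (D₀.Y i))
    (hXY : D.Xᵀ *ᵥ D.Y = D₀.Xᵀ *ᵥ D₀.Y) (βhat βtil : Coef p) (a : ℝ) :
    laplaceKernel q b π D D₀ βhat βtil a =
      π a * ((Real.exp (-powerNegLogLik q b D D₀ 1 a βhat) / √(powerInfo b D D₀ 1 a βhat).det) /
        (Real.exp (-powerNegLogLik q b D D₀ 0 a βtil) / √(powerInfo b D D₀ 0 a βtil).det)) := by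
  have hn' : (0 : ℝ) < D.n := by positivity
  have hG : sigmaG b D D₀ a βhat = ((1 / (D.n : ℝ)) • powerInfo b D D₀ 1 a βhat)⁻¹ := by
    rw [sigmaG, powerInfo, one_smul, smul_add, smul_smul]
    congr 3
    ring
  have hKm : sigmaK b D D₀ a βtil = ((1 / (D.n : ℝ)) • powerInfo b D D₀ 0 a βtil)⁻¹ := by
    rw [sigmaK, powerInfo, zero_smul, zero_add, smul_smul]
    congr 2
    ring
  have hE : -(D.n : ℝ) * (g q b D D₀ a βhat - k b D D₀ a βtil) =
      -powerNegLogLik q b D D₀ 1 a βhat - -powerNegLogLik q b D D₀ 0 a βtil := by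
    rw [mul_sub, neg_mul_g_eq hn hq hq₀ hXY, neg_mul_k_eq hn hq hq₀ hXY]
    ring
  have hc : √((1 / (D.n : ℝ)) ^ p) ≠ 0 := by positivity
  rw [laplaceKernel, hE, Real.exp_sub, hG, hKm, sqrt_det_inv_smul _ (by positivity),
    sqrt_det_inv_smul _ (by positivity), mul_div_mul_left _ _ (inv_ne_zero hc)]
  simp only [div_eq_mul_inv, mul_inv, inv_inv]
  ring

theorem likelihood_mul_rpow_eq_exp (hq : ∀ i, 0 < q (D.Y i)) (hq₀ : ∀ i, 0 < q (D₀.Y i)) (a : ℝ)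
    (β : Coef p) : likelihood q b D β * likelihood q b D₀ β ^ a =
      Real.exp (-powerNegLogLik q b D D₀ 1 a β) := by
  rw [likelihood_eq_exp hq, likelihood_rpow_eq_exp hq₀, ← Real.exp_add, powerNegLogLik]
  ring_nf

theorem likelihood_rpow_eq_exp_powerNegLogLik (D : Data p) (hq₀ : ∀ i, 0 < q (D₀.Y i)) (a : ℝ)
    (β : Coef p) : likelihood q b D₀ β ^ a = Real.exp (-powerNegLogLik q b D D₀ 0 a β) := by
  rw [likelihood_rpow_eq_exp hq₀, powerNegLogLik, zero_mul, zero_add]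

theorem marginalKernel_eq (hq : ∀ i, 0 < q (D.Y i)) (hq₀ : ∀ i, 0 < q (D₀.Y i)) (a : ℝ) :
    marginalKernel q b π₀ π D D₀ a =
      π a * ((∫ β, Real.exp (-powerNegLogLik q b D D₀ 1 a β) * π₀ β) /
        ∫ β, Real.exp (-powerNegLogLik q b D D₀ 0 a β) * π₀ β) := by
  have hc : normConst q b π₀ D₀ a =
      ∫ β, Real.exp (-powerNegLogLik q b D D₀ 0 a β) * π₀ β := by
    simp only [normConst, likelihood_rpow_eq_exp_powerNegLogLik D hq₀]
  rw [marginalKernel, ← hc, mul_div_assoc', ← integral_const_mul, ← integral_div]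
  congr 1
  ext β
  rw [jointKernel, ← likelihood_mul_rpow_eq_exp hq hq₀]
  ring

theorem asympEqOn_of_tendsto {K : Set ℝ} {f h : ℕ → ℝ → ℝ} {R : ℕ × ℝ → ℝ}
    (hR : Tendsto R (atTop ×ˢ 𝓟 K) (𝓝 1))
    (heq : ∀ᶠ i in atTop ×ˢ 𝓟 K, f i.1 i.2 = h i.1 i.2 * R i) : AsympEqOn K f h := by
  intro ε hε
  have : ∀ᶠ i : ℕ × ℝ in atTop ×ˢ 𝓟 K, |f i.1 i.2 - h i.1 i.2| ≤ ε * |h i.1 i.2| := by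
    filter_upwards [heq, Metric.tendsto_nhds.1 hR ε hε] with i hi hd
    rw [Real.dist_eq] at hd
    rw [hi, ← mul_sub_one, abs_mul, mul_comm]
    gcongr
  exact eventually_prod_principal_iff.1 this

/-- On `(0, 1]` the kernel is `π` times a positive quotient, so it vanishes only where `π` does; as
`π` has integral `1`, its support has positive measure. -/
theorem integral_marginalKernel_pos (hq : ∀ i, 0 < q (D.Y i)) (hq₀ : ∀ i, 0 < q (D₀.Y i))
    (hπ₀ : ∀ β, 0 ≤ π₀ β) {z : Coef p} (hz : ContinuousAt π₀ z) (hz0 : 0 < π₀ z)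
    (hπ : ∀ a ∈ Ioc (0 : ℝ) 1, 0 ≤ π a) (hπ1 : ∫ a in (0 : ℝ)..1, π a = 1)
    (hprior : ∀ a ∈ Ioc (0 : ℝ) 1,
      Integrable fun β => Real.exp (-powerNegLogLik q b D D₀ 0 a β) * π₀ β)
    (hpost : ∀ a ∈ Ioc (0 : ℝ) 1,
      Integrable fun β => Real.exp (-powerNegLogLik q b D D₀ 1 a β) * π₀ β)
    (hmarg : IntervalIntegrable (marginalKernel q b π₀ π D D₀) volume 0 1) :
    0 < ∫ a in (0 : ℝ)..1, marginalKernel q b π₀ π D D₀ a := by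
  have hpos : ∀ a ∈ Ioc (0 : ℝ) 1, 0 <
      (∫ β, Real.exp (-powerNegLogLik q b D D₀ 1 a β) * π₀ β) /
        ∫ β, Real.exp (-powerNegLogLik q b D D₀ 0 a β) * π₀ β := fun a ha =>
    div_pos (integral_mul_pos_of_continuousAt (fun _ => Real.exp_pos _) hπ₀ hz hz0 (hpost a ha))
      (integral_mul_pos_of_continuousAt (fun _ => Real.exp_pos _) hπ₀ hz hz0 (hprior a ha))
  have hnn : ∀ f : ℝ → ℝ, (∀ a ∈ Ioc (0 : ℝ) 1, 0 ≤ f a) →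
      0 ≤ᵐ[volume.restrict (uIoc 0 1)] f := fun f hf => by
    rw [uIoc_of_le zero_le_one]
    exact (ae_restrict_iff' measurableSet_Ioc).2 (Eventually.of_forall hf)
  -- A non-integrable function has integral `0` by convention, so integral `1` already yields
  -- integrability.
  have hπi : IntervalIntegrable π volume 0 1 :=
    intervalIntegral.intervalIntegrable_of_integral_ne_zero (by rw [hπ1]; exact one_ne_zero)
  have hπs := (intervalIntegral.integral_pos_iff_support_of_nonneg_ae' (hnn π hπ) hπi).1
    (by rw [hπ1]; exact one_pos)
  refine (intervalIntegral.integral_pos_iff_support_of_nonneg_ae' (hnn _ fun a ha => ?_) hmarg).2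
    ⟨zero_lt_one, hπs.2.trans_le (measure_mono fun a ha => ⟨?_, ha.2⟩)⟩
  · rw [marginalKernel_eq hq hq₀]
    exact mul_nonneg (hπ a ha) (hpos a ha).le
  · rw [Function.mem_support, marginalKernel_eq hq hq₀]
    exact mul_ne_zero ha.1 (hpos a ha.2).ne'

theorem integral_exp_neg_norm_sq_half_pos : 0 < ∫ u : Coef p, Real.exp (-(‖u‖ ^ 2 / 2)) := by
  have := GaussianFourier.integral_rexp_neg_mul_sq_norm (V := Coef p) (b := 1 / 2) (by norm_num)
  have h : ∀ u : Coef p, -(‖u‖ ^ 2 / 2) = -(1 / 2) * ‖u‖ ^ 2 := fun u => by ring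
  simp only [h, this]
  positivity

end Posterior

/-! ### Assembling the asymptotic formula. -/

/-- Splits the posterior into `C_n`, the Laplace kernel, the prior ratio and a quotient of two
Laplace ratios, the last of which tends to `1`. -/
theorem div_eq_inv_mul_mul_ratio {EG EK rG rK sG sK : ℝ} (P IG IK Z : ℝ) (hG : EG / sG ≠ 0)
    (hK : EK / sK ≠ 0) (hrG : rG ≠ 0) (hrK : rK ≠ 0) :
    P * (IG / IK) / Z = Z⁻¹ * (P * ((EG / sG) / (EK / sK)) * (rG / rK)) *
      ((IG / (EG * rG / sG)) / (IK / (EK * rK / sK))) := by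
  have h1 : EG * rG / sG = EG / sG * rG := by ring
  have h2 : EK * rK / sK = EK / sK * rK := by ring
  rw [h1, h2]
  generalize EG / sG = x at *
  generalize EK / sK = y at *
  field_simp

theorem theorem2p4 {p : ℕ} (q b : ℝ → ℝ) (π₀ : Coef p → ℝ) (π : ℝ → ℝ) (r : ℝ)
    (D D₀ : ℕ → Data p) (βhat βtil : ℕ → ℝ → Coef p)
    -- the exponential family
    (hb : ContDiff ℝ 2 b) (hb'' : ∀ t, 0 < deriv (deriv b) t)
    (hq : ∀ m i, 0 < q ((D m).Y i)) (hq₀ : ∀ m i, 0 < q ((D₀ m).Y i))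
    -- the sample sizes, the designs, and the equality of the sufficient statistics
    (hr : 0 < r) (hn : Tendsto (fun m => (D m).n) atTop atTop)
    (hn₀ : ∀ m, ((D₀ m).n : ℝ) = r * (D m).n)
    (hX : ∀ m, (D m).X.rank = p) (hX₀ : ∀ m, (D₀ m).X.rank = p)
    (hXY : ∀ m, (D m).Xᵀ *ᵥ (D m).Y = (D₀ m).Xᵀ *ᵥ (D₀ m).Y)
    -- the priors
    (hπ₀ : ∀ β, 0 ≤ π₀ β)
    (hπ : ∀ a ∈ Ioc (0 : ℝ) 1, 0 ≤ π a) (hπ1 : ∫ a in (0 : ℝ)..1, π a = 1)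
    -- the normalized power prior and the posterior are proper
    (hprior : ∀ m, ∀ a ∈ Ioc (0 : ℝ) 1,
      Integrable fun β => likelihood q b (D₀ m) β ^ a * π₀ β)
    (hpost : ∀ m, ∀ a ∈ Ioc (0 : ℝ) 1,
      Integrable fun β => likelihood q b (D m) β * likelihood q b (D₀ m) β ^ a * π₀ β)
    (hmarg : ∀ m,
      IntervalIntegrable (marginalKernel q b π₀ π (D m) (D₀ m)) volume 0 1)
    -- the maximizers
    (hβhat : ∀ m, ∀ a ∈ Ioc (0 : ℝ) 1,
      IsMaxOn (fun β => -g q b (D m) (D₀ m) a β) univ (βhat m a))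
    (hβtil : ∀ m, ∀ a ∈ Ioc (0 : ℝ) 1,
      IsMaxOn (fun β => -k b (D m) (D₀ m) a β) univ (βtil m a)) :
    ∃ C : ℕ → ℝ, (∀ m, 0 < C m) ∧ ∀ K ⊆ Ioc (0 : ℝ) 1,
      BayesCLT K π₀ (fun m a β => likelihood q b (D m) β * likelihood q b (D₀ m) β ^ a)
        (fun m a β => infoG b (D m) (D₀ m) a β) βhat →
      BayesCLT K π₀ (fun m a β => likelihood q b (D₀ m) β ^ a)
        (fun m a β => infoK b (D₀ m) a β) βtil →
      (TendstoUniformlyOn (fun m a => π₀ (βhat m a) / π₀ (βtil m a)) (fun _ => 1) atTop K →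
        AsympEqOn K (fun m a => marginalPosterior q b π₀ π (D m) (D₀ m) a)
          (fun m a => C m * laplaceKernel q b π (D m) (D₀ m) (βhat m a) (βtil m a) a)) ∧
      AsympEqOn K (fun m a => marginalPosterior q b π₀ π (D m) (D₀ m) a)
        (fun m a => C m * (laplaceKernel q b π (D m) (D₀ m) (βhat m a) (βtil m a) a *
          (π₀ (βhat m a) / π₀ (βtil m a)))) := by
  -- `C` must be fixed before `K`, while positivity of the normalizing integral is derived from
  -- regularity on a nonempty `K`; hence the default value `1`.
  refine ⟨fun m => if 0 < ∫ a in (0 : ℝ)..1, marginalKernel q b π₀ π (D m) (D₀ m) a then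
    (∫ a in (0 : ℝ)..1, marginalKernel q b π₀ π (D m) (D₀ m) a)⁻¹ else 1, fun m => ?_, ?_⟩
  · dsimp only
    split_ifs with h
    · exact inv_pos.2 h
    · exact one_pos
  intro K hK hregG hregK
  rcases K.eq_empty_or_nonempty with rfl | hKne
  · simp [AsympEqOn]
  obtain ⟨z, hz, hz0⟩ := hregG.exists_continuousAt_pos hKne
  simp only [likelihood_mul_rpow_eq_exp (hq _) (hq₀ _)] at hregG hpost
  have hprior' : ∀ m, ∀ a ∈ Ioc (0 : ℝ) 1,
      Integrable fun β => Real.exp (-powerNegLogLik q b (D m) (D₀ m) 0 a β) * π₀ β := by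
    intro m a ha
    simpa only [likelihood_rpow_eq_exp_powerNegLogLik (D m) (hq₀ m)] using hprior m a ha
  have hZ : ∀ m, 0 < ∫ a in (0 : ℝ)..1, marginalKernel q b π₀ π (D m) (D₀ m) a := fun m =>
    integral_marginalKernel_pos (hq m) (hq₀ m) hπ₀ hz hz0 hπ hπ1 (hprior' m) (hpost m) (hmarg m)
  have hπ₀m : AEStronglyMeasurable π₀ volume :=
    aestronglyMeasurable_of_integrable_exp_neg_mul
      (continuous_powerNegLogLik hb (hq 0) (hq₀ 0) 0 1) (hprior' 0 1 ⟨one_pos, le_rfl⟩)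
  have hJG : (fun m a β => infoG b (D m) (D₀ m) a β) =
      fun m a β => powerInfo b (D m) (D₀ m) 1 a β := by
    funext m a β
    rw [infoG, powerInfo, one_smul]
  have hJK : (fun m a β => infoK b (D₀ m) a β) =
      fun m a β => powerInfo b (D m) (D₀ m) 0 a β := by
    funext m a β
    rw [infoK, powerInfo, zero_smul, zero_add]
  have hlK : (fun m a β => likelihood q b (D₀ m) β ^ a) =
      fun (m : ℕ) (a : ℝ) β => Real.exp (-powerNegLogLik q b (D m) (D₀ m) 0 a β) := by
    funext m a β
    exact likelihood_rpow_eq_exp_powerNegLogLik (D m) (hq₀ m) a β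
  rw [hJG] at hregG
  rw [hJK, hlK] at hregK
  have hnpos : ∀ᶠ m in atTop, 0 < (D m).n := hn.eventually_gt_atTop 0
  have hK0 : ∀ a ∈ K, 0 ≤ a := fun a ha => (hK ha).1.le
  obtain ⟨hpG, hdG, hlimG⟩ := tendsto_laplace_powerPosterior hK0 zero_le_one hb hb'' hq hq₀ hπ₀
    hπ₀m (fun m a ha => hpost m a (hK ha)) (by
      filter_upwards [hnpos] with m hm a ha β
      have h : -g q b (D m) (D₀ m) a β ≤ -g q b (D m) (D₀ m) a (βhat m a) :=
        hβhat m a (hK ha) (mem_univ β)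
      have h1 := neg_mul_g_eq (b := b) hm (hq m) (hq₀ m) (hXY m) a
      have h2 := mul_le_mul_of_nonneg_left h (Nat.cast_nonneg (α := ℝ) (D m).n)
      rw [mul_neg, mul_neg, ← neg_mul, ← neg_mul, h1, h1] at h2
      linarith) hregG
  obtain ⟨hpK, hdK, hlimK⟩ := tendsto_laplace_powerPosterior hK0 le_rfl hb hb'' hq hq₀ hπ₀
    hπ₀m (fun m a ha => hprior' m a (hK ha)) (by
      filter_upwards [hnpos] with m hm a ha β
      have h : -k b (D m) (D₀ m) a β ≤ -k b (D m) (D₀ m) a (βtil m a) :=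
        hβtil m a (hK ha) (mem_univ β)
      have h1 := neg_mul_k_eq (b := b) hm (hq m) (hq₀ m) (hXY m) a
      have h2 := mul_le_mul_of_nonneg_left h (Nat.cast_nonneg (α := ℝ) (D m).n)
      rw [mul_neg, mul_neg, ← neg_mul, ← neg_mul, h1, h1] at h2
      linarith) hregK
  have hG := (integral_exp_neg_norm_sq_half_pos (p := p)).ne'
  -- Both ratios tend to the same nonzero Gaussian integral, so their quotient tends to `1`.
  have hlim := hlimG.div hlimK hG
  rw [div_self hG] at hlim
  have hnl : ∀ᶠ i : ℕ × ℝ in atTop ×ˢ 𝓟 K, 0 < (D i.1).n :=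
    eventually_prod_principal_iff.2 (hnpos.mono fun m hm _ _ => hm)
  have hfac : ∀ᶠ i : ℕ × ℝ in atTop ×ˢ 𝓟 K,
      marginalPosterior q b π₀ π (D i.1) (D₀ i.1) i.2 =
        (if 0 < ∫ a in (0 : ℝ)..1, marginalKernel q b π₀ π (D i.1) (D₀ i.1) a then
          (∫ a in (0 : ℝ)..1, marginalKernel q b π₀ π (D i.1) (D₀ i.1) a)⁻¹ else 1) *
        (laplaceKernel q b π (D i.1) (D₀ i.1) (βhat i.1 i.2) (βtil i.1 i.2) i.2 *
          (π₀ (βhat i.1 i.2) / π₀ (βtil i.1 i.2))) *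
        (laplaceRatio q b π₀ (D i.1) (D₀ i.1) 1 i.2 (βhat i.1 i.2) /
          laplaceRatio q b π₀ (D i.1) (D₀ i.1) 0 i.2 (βtil i.1 i.2)) := by
    filter_upwards [hnl, hpG, hdG, hpK, hdK] with i hn hpG hdG hpK hdK
    rw [if_pos (hZ i.1), marginalPosterior, marginalKernel_eq (hq _) (hq₀ _),
      laplaceKernel_eq hn (hq _) (hq₀ _) (hXY _)]
    have hsG := Real.sqrt_pos.2 hdG
    have hsK := Real.sqrt_pos.2 hdK
    exact div_eq_inv_mul_mul_ratio _ _ _ _ (by positivity) (by positivity) hpG.ne' hpK.ne'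
  refine ⟨fun hratio => ?_, asympEqOn_of_tendsto hlim hfac⟩
  have hratio' : Tendsto (fun i : ℕ × ℝ => π₀ (βhat i.1 i.2) / π₀ (βtil i.1 i.2))
      (atTop ×ˢ 𝓟 K) (𝓝 1) := by
    rw [Metric.tendsto_nhds]
    intro ε hε
    rw [eventually_prod_principal_iff]
    filter_upwards [Metric.tendstoUniformlyOn_iff.1 hratio ε hε] with m hm a ha
    rw [dist_comm]
    exact hm a ha
  -- When the prior ratio tends to `1` uniformly, it is absorbed into the factor `1 + o(1)`.
  have hlim' := hratio'.mul hlim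
  rw [one_mul] at hlim'
  refine asympEqOn_of_tendsto hlim' (hfac.mono fun i hi => hi.trans ?_)
  simp only [Pi.div_apply]
  ring
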